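/- Let $(X,\mathcal B,\mu)$ be a probability space, $T:X\to X$ an ergodic measure-preserving transformation, $d\ge 1$, and $f:X\to\mathbb Z^d$ a measurable function. Put $f_0=0$ and, for $k\ge1$, $f_k(x)=\sum_{j=0}^{k-1}f(T^jx)$, and for $n\ge 1$ let $$V_n(x)=\#\{(j,k):\ 1\le j,k\le n,\ f_j(x)=f_k(x)\}$$ be the number of self-intersections up to time $n$. Then there is a constant $\beta\ge0$ such that $\lim_{n\to\infty}V_n(x)/n^2=\beta$ for $\mu$-a.e. $x\in X$. Moreover, $\beta>0$ if and only if the cocycle $(T,f)$ is a coboundary, i.e. there is a measurable function $\Phi:X\to\mathbb R^d$ such that $f=\Phi\circ T-\Phi$ $\mu$-a.e. -/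

import Mathlib

open MeasureTheory Filter Topology

/-- The number of self-intersections up to time `n` of the cocycle generated by `f` over `T`, at `x`:
the number of pairs `(j, k)` with `1 ≤ j, k ≤ n` and `f_j(x) = f_k(x)`, where
`f_k(x) = ∑_{0 ≤ i < k} f(T^i x)` is the ergodic sum `birkhoffSum T f k x`. -/
def selfIntersections {X : Type*} {d : ℕ} (T : X → X) (f : X → Fin d → ℤ) (n : ℕ) (x : X) : ℕ :=
  (((Finset.Icc 1 n) ×ˢ (Finset.Icc 1 n)).filter
    (fun p : ℕ × ℕ => birkhoffSum T f p.1 x = birkhoffSum T f p.2 x)).card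

/-- The cocycle generated by the `ℤ^d`-valued function `f` over `T` is a coboundary: there is a
measurable `Φ` with values in `ℝ^d` such that `f = Φ ∘ T - Φ` almost everywhere. -/
def IsCoboundary {X : Type*} [MeasurableSpace X] {d : ℕ} (μ : Measure X) (T : X → X)
    (f : X → Fin d → ℤ) : Prop :=
  ∃ Φ : X → Fin d → ℝ, Measurable Φ ∧
    ∀ᵐ x ∂μ, ∀ i : Fin d, (f x i : ℝ) = Φ (T x) i - Φ x i

/-! If `f` is a coboundary, taking floors gives an integer-valued transfer function `Ψ`, and `f_j(x)
= f_k(x)` exactly when `Ψ(T^j x) = Ψ(T^k x)`. By Birkhoff's theorem each value `y` is taken with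
frequency `μ(Ψ = y)`, so `V_n/n²` tends to `∑ μ(Ψ = y)²`, which is positive.

If `f` is not a coboundary, consider the skew product on `X × ℤ^d` with the invariant measure `μ ×
count`. It has no invariant set of positive finite measure: the fibres of such a set would have
constant finite cardinality, and their barycentre would be a transfer function
(`isCoboundary_of_preimage_skewProduct_eq`). By the maximal inequality, the points visiting `X ×
{0}` with upper frequency above `a > 0` form an invariant set of measure at most `1/a`, hence a null
set. So the sums `f_k` return to `0` with frequency zero almost everywhere, and
`Ergodic.ae_tendsto_sum_iterate_div_sq` averages this along the orbit to get `V_n = o(n²)`. -/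

/-- The number of visits of the orbit segment `x, T x, …, T^(n-1) x` to the set `A`. -/
noncomputable def visits {X : Type*} (T : X → X) (A : Set X) (n : ℕ) (x : X) : ℝ :=
  birkhoffSum T (A.indicator fun _ => (1 : ℝ)) n x

/-- The points whose orbit visits `A` with upper frequency larger than `a`. -/
def frequentVisits {X : Type*} (T : X → X) (A : Set X) (a : ℝ) : Set X :=
  ⋃ j : ℕ, limsup (fun n : ℕ => {x | (a + 1 / ((j : ℝ) + 1)) * n < visits T A n x}) atTop

/-! ### Visit counts and upper frequencies -/

section Visits

variable {X : Type*} {T : X → X} {A : Set X}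

theorem indicator_one_mem_Icc (A : Set X) (x : X) :
    A.indicator (fun _ => (1 : ℝ)) x ∈ Set.Icc (0 : ℝ) 1 := by
  by_cases h : x ∈ A <;> simp [h]

theorem visits_nonneg (n : ℕ) (x : X) : 0 ≤ visits T A n x := by
  unfold visits birkhoffSum
  exact Finset.sum_nonneg fun _ _ => (indicator_one_mem_Icc A _).1

theorem visits_le (n : ℕ) (x : X) : visits T A n x ≤ n := by
  have : visits T A n x ≤ ∑ _k ∈ Finset.range n, (1 : ℝ) := by
    unfold visits birkhoffSum
    exact Finset.sum_le_sum fun _ _ => (indicator_one_mem_Icc A _).2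
  simpa using this

open Classical in
theorem visits_eq_card (n : ℕ) (x : X) :
    visits T A n x = ((Finset.range n).filter fun k => T^[k] x ∈ A).card := by
  simp [visits, birkhoffSum, Set.indicator_apply]

theorem visits_add_visits_compl (n : ℕ) (x : X) : visits T A n x + visits T Aᶜ n x = n := by
  simp only [visits, birkhoffSum, ← Finset.sum_add_distrib]
  rw [Finset.sum_congr rfl (fun k _ => Set.indicator_self_add_compl_apply A (fun _ => (1 : ℝ)) _)]
  simp

theorem abs_visits_apply_sub_visits_le (n : ℕ) (x : X) :
    |visits T A n (T x) - visits T A n x| ≤ 1 := by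
  rw [visits, visits, birkhoffSum_apply_sub_birkhoffSum, abs_le]
  have h1 := indicator_one_mem_Icc A (T^[n] x)
  have h2 := indicator_one_mem_Icc A x
  constructor <;> linarith [h1.1, h1.2, h2.1, h2.2]

theorem mem_frequentVisits {a : ℝ} {x : X} : x ∈ frequentVisits T A a ↔
    ∃ j : ℕ, ∃ᶠ n : ℕ in atTop, (a + 1 / ((j : ℝ) + 1)) * n < visits T A n x := by
  simp [frequentVisits, Filter.mem_limsup_iff_frequently_mem]

theorem mem_frequentVisits_of_abs_sub_le {a : ℝ} {x y : X}
    (h : ∀ n, |visits T A n y - visits T A n x| ≤ 1) (hx : x ∈ frequentVisits T A a) :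
    y ∈ frequentVisits T A a := by
  rw [mem_frequentVisits] at hx ⊢
  obtain ⟨j, hj⟩ := hx
  -- Passing to a smaller margin leaves room growing linearly in `n`, which eventually absorbs the
  -- discrepancy of `1`.
  refine ⟨j + 1, hj.mp ?_⟩
  have hpos : (0 : ℝ) < 1 / ((j : ℝ) + 1) - 1 / ((j : ℝ) + 1 + 1) := by
    rw [sub_pos]
    exact one_div_lt_one_div_of_lt (by positivity) (by linarith)
  have hlim : Tendsto (fun n : ℕ => (1 / ((j : ℝ) + 1) - 1 / ((j : ℝ) + 1 + 1)) * (n : ℝ))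
      atTop atTop := tendsto_natCast_atTop_atTop.const_mul_atTop hpos
  filter_upwards [hlim.eventually_ge_atTop 1] with n hn hlt
  have := (abs_le.1 (h n)).1
  push_cast
  nlinarith

/-- One step of `T` changes a visit count by at most one, so the invariance is exact, not only
modulo null sets. -/
theorem preimage_frequentVisits (T : X → X) (A : Set X) (a : ℝ) :
    T ⁻¹' frequentVisits T A a = frequentVisits T A a := by
  ext x
  refine ⟨mem_frequentVisits_of_abs_sub_le fun n => ?_,
    mem_frequentVisits_of_abs_sub_le fun n => abs_visits_apply_sub_visits_le n x⟩
  rw [abs_sub_comm]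
  exact abs_visits_apply_sub_visits_le n x

theorem eventually_visits_le {a b : ℝ} (hab : a < b) {x : X} (hx : x ∉ frequentVisits T A a) :
    ∀ᶠ n : ℕ in atTop, visits T A n x ≤ b * n := by
  rw [mem_frequentVisits] at hx
  push Not at hx
  obtain ⟨j, hj⟩ := exists_nat_one_div_lt (sub_pos.2 hab)
  filter_upwards [hx j] with n hn
  refine hn.trans ?_
  gcongr
  linarith

variable [MeasurableSpace X]

theorem measurable_visits (hT : Measurable T) (hA : MeasurableSet A) (n : ℕ) :
    Measurable (visits T A n) := by
  unfold visits birkhoffSum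
  exact Finset.measurable_fun_sum _ fun k _ =>
    (measurable_const.indicator hA).comp (hT.iterate k)

theorem measurableSet_frequentVisits (hT : Measurable T) (hA : MeasurableSet A) (a : ℝ) :
    MeasurableSet (frequentVisits T A a) :=
  MeasurableSet.iUnion fun _ => MeasurableSet.measurableSet_limsup fun n =>
    measurableSet_lt measurable_const (measurable_visits hT hA n)

end Visits

/-! ### The maximal ergodic theorem and inequality -/

/-- The maximum of `0` and the first `n` Birkhoff sums. -/
noncomputable def birkhoffMax {X : Type*} (T : X → X) (g : X → ℝ) : ℕ → X → ℝ
  | 0 => fun _ => 0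
  | n + 1 => fun x => max 0 (g x + birkhoffMax T g n (T x))

section Maximal

variable {X : Type*} {T : X → X} {g : X → ℝ}

theorem birkhoffMax_nonneg (n : ℕ) (x : X) : 0 ≤ birkhoffMax T g n x := by
  cases n with
  | zero => exact le_rfl
  | succ n => exact le_max_left _ _

theorem birkhoffMax_le_succ (n : ℕ) (x : X) :
    birkhoffMax T g n x ≤ birkhoffMax T g (n + 1) x := by
  induction n generalizing x with
  | zero => exact birkhoffMax_nonneg _ _
  | succ n ih => exact max_le_max le_rfl (add_le_add le_rfl (ih _))

theorem birkhoffSum_le_birkhoffMax {k n : ℕ} (h : k ≤ n) (x : X) :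
    birkhoffSum T g k x ≤ birkhoffMax T g n x := by
  induction n generalizing k x with
  | zero => simp [Nat.le_zero.1 h, birkhoffMax]
  | succ n ih =>
    cases k with
    | zero => simpa using birkhoffMax_nonneg (n + 1) x
    | succ k =>
      rw [birkhoffSum_succ']
      exact (add_le_add le_rfl (ih (Nat.le_of_succ_le_succ h) _)).trans (le_max_right _ _)

variable [MeasurableSpace X] {μ : Measure X}

theorem measurable_birkhoffMax (hT : Measurable T) (hg : Measurable g) (n : ℕ) :
    Measurable (birkhoffMax T g n) := by
  induction n with
  | zero => exact measurable_const
  | succ n ih => exact measurable_const.max (hg.add (ih.comp hT))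

theorem integrable_birkhoffMax (hT : MeasurePreserving T μ μ) (hg : Integrable g μ) (n : ℕ) :
    Integrable (birkhoffMax T g n) μ := by
  induction n with
  | zero => exact integrable_zero _ _ _
  | succ n ih => exact (integrable_zero _ _ _).sup (hg.add (hT.integrable_comp_of_integrable ih))

/-- The maximal ergodic theorem. -/
theorem setIntegral_birkhoffMax_pos_nonneg (hT : MeasurePreserving T μ μ) (hgm : Measurable g)
    (hg : Integrable g μ) (n : ℕ) : 0 ≤ ∫ x in {x | 0 < birkhoffMax T g n x}, g x ∂μ := by
  cases n with
  | zero => simp [birkhoffMax]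
  | succ n =>
    set D := {x | 0 < birkhoffMax T g (n + 1) x}
    have hD : MeasurableSet D :=
      measurableSet_lt measurable_const (measurable_birkhoffMax hT.measurable hgm _)
    have hM := integrable_birkhoffMax hT hg n
    have hM1 := integrable_birkhoffMax hT hg (n + 1)
    have hMT : Integrable (fun x => birkhoffMax T g n (T x)) μ :=
      hT.integrable_comp_of_integrable hM
    -- Garsia's argument: where the maximum is positive the recursion takes its second branch, so
    -- `g` is a difference whose integral is controlled by invariance of `μ` and monotonicity in
    -- `n`.
    have hgD : ∀ x ∈ D, g x = birkhoffMax T g (n + 1) x - birkhoffMax T g n (T x) := by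
      intro x hx
      have hx' : 0 < max 0 (g x + birkhoffMax T g n (T x)) := hx
      have : birkhoffMax T g (n + 1) x = g x + birkhoffMax T g n (T x) :=
        max_eq_right (by
          rcases lt_max_iff.1 hx' with h | h
          · exact absurd h (lt_irrefl _)
          · exact h.le)
      rw [this]; ring
    rw [setIntegral_congr_fun hD hgD, integral_sub hM1.integrableOn hMT.integrableOn]
    have h1 : ∫ x in D, birkhoffMax T g (n + 1) x ∂μ = ∫ x, birkhoffMax T g (n + 1) x ∂μ :=
      setIntegral_eq_integral_of_forall_compl_eq_zero fun x hx =>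
        le_antisymm (not_lt.1 hx) (birkhoffMax_nonneg _ _)
    have h2 : ∫ x in D, birkhoffMax T g n (T x) ∂μ ≤ ∫ x, birkhoffMax T g n (T x) ∂μ :=
      setIntegral_le_integral hMT (ae_of_all _ fun x => birkhoffMax_nonneg _ _)
    have h3 : ∫ x, birkhoffMax T g n (T x) ∂μ = ∫ x, birkhoffMax T g n x ∂μ := by
      rw [← integral_map hT.measurable.aemeasurable (by
        rw [hT.map_eq]; exact hM.aestronglyMeasurable), hT.map_eq]
    have h4 : ∫ x, birkhoffMax T g n x ∂μ ≤ ∫ x, birkhoffMax T g (n + 1) x ∂μ :=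
      integral_mono hM hM1 fun x => birkhoffMax_le_succ n x
    linarith

variable {A : Set X}

/-- The maximal theorem is applied to `1_A - a 1_B`, with `B` the set being measured. Using `1_B` in
place of the constant `1` keeps the function integrable when `μ` is infinite, and costs nothing
because there are at most `k` visits to `B` in time `k`. -/
theorem mul_measure_exists_le_visits_gt_le (hT : MeasurePreserving T μ μ) (hA : MeasurableSet A)
    (hμA : μ A ≠ ⊤) {a : ℝ} (ha : 0 < a) (n : ℕ) :
    ENNReal.ofReal a * μ {x | ∃ k ≤ n, a * k < visits T A k x} ≤ μ A := by
  set B := {x | ∃ k ≤ n, a * k < visits T A k x}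
  have hB : MeasurableSet B := by
    have : B = ⋃ k, ⋃ _ : k ≤ n, {x | a * k < visits T A k x} := by ext; simp [B]
    rw [this]
    exact MeasurableSet.iUnion fun k => MeasurableSet.iUnion fun _ =>
      measurableSet_lt measurable_const (measurable_visits hT.measurable hA k)
  have hμB : μ B ≠ ⊤ := by
    have hsub : B ⊆ ⋃ i ∈ Finset.range n, T^[i] ⁻¹' A := by
      rintro x ⟨k, hk, hx⟩
      by_contra hcon
      simp only [Set.mem_iUnion, not_exists, Finset.mem_range, Set.mem_preimage] at hcon
      have : visits T A k x = 0 := Finset.sum_eq_zero fun i hi =>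
        Set.indicator_of_notMem (hcon i ((Finset.mem_range.1 hi).trans_le hk)) _
      have : 0 ≤ a * k := by positivity
      linarith
    refine ((measure_mono hsub).trans_lt ?_).ne
    refine (measure_biUnion_finset_le _ _).trans_lt (ENNReal.sum_lt_top.2 fun i _ => ?_)
    rw [(hT.iterate i).measure_preimage hA.nullMeasurableSet]
    exact hμA.lt_top
  set g : X → ℝ := A.indicator (fun _ => (1 : ℝ)) - a • B.indicator (fun _ => (1 : ℝ))
  have hiA : Integrable (A.indicator (fun _ => (1 : ℝ))) μ :=
    (integrable_indicator_iff hA).2 (integrableOn_const hμA)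
  have hiB : Integrable (a • B.indicator (fun _ => (1 : ℝ))) μ :=
    ((integrable_indicator_iff hB).2 (integrableOn_const hμB)).smul a
  have hgm : Measurable g :=
    (measurable_const.indicator hA).sub ((measurable_const.indicator hB).const_smul a)
  have hmax := setIntegral_birkhoffMax_pos_nonneg hT hgm (hiA.sub hiB) n
  set D := {x | 0 < birkhoffMax T g n x}
  have hD : MeasurableSet D :=
    measurableSet_lt measurable_const (measurable_birkhoffMax hT.measurable hgm _)
  have hBD : B ⊆ D := by
    rintro x ⟨k, hk, hx⟩
    refine lt_of_lt_of_le ?_ (birkhoffSum_le_birkhoffMax hk x)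
    have : birkhoffSum T g k x = visits T A k x - a * visits T B k x := by
      simp [g, visits, birkhoffSum, Finset.mul_sum]
    rw [this]
    have := mul_le_mul_of_nonneg_left (visits_le (T := T) (A := B) k x) ha.le
    linarith
  have hint : ∫ x in D, g x ∂μ = μ.real (A ∩ D) - a * μ.real B := by
    have e1 : ∫ x in D, A.indicator (fun _ => (1 : ℝ)) x ∂μ = μ.real (A ∩ D) := by
      rw [integral_indicator hA, Measure.restrict_restrict hA]; simp
    have e2 : ∫ x in D, B.indicator (fun _ => (1 : ℝ)) x ∂μ = μ.real B := by
      rw [integral_indicator hB, Measure.restrict_restrict hB, Set.inter_eq_left.2 hBD]; simp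
    simp only [g]
    rw [integral_sub' hiA.integrableOn hiB.integrableOn, e1]
    simp only [Pi.smul_apply]
    rw [integral_smul, e2, smul_eq_mul]
  have hle : a * μ.real B ≤ μ.real A := by
    have : μ.real (A ∩ D) ≤ μ.real A := measureReal_mono Set.inter_subset_left hμA
    linarith
  rw [← ENNReal.ofReal_toReal hμB, ← ENNReal.ofReal_toReal hμA, ← ENNReal.ofReal_mul ha.le]
  exact ENNReal.ofReal_le_ofReal hle

theorem mul_measure_frequentVisits_le (hT : MeasurePreserving T μ μ) (hA : MeasurableSet A)
    (hμA : μ A ≠ ⊤) {a : ℝ} (ha : 0 < a) :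
    ENNReal.ofReal a * μ (frequentVisits T A a) ≤ μ A := by
  set B : ℕ → Set X := fun n => {x | ∃ k ≤ n, a * k < visits T A k x}
  have hmono : Monotone B := fun m n hmn x ⟨k, hk, hx⟩ => ⟨k, hk.trans hmn, hx⟩
  have hsub : frequentVisits T A a ⊆ ⋃ n, B n := by
    intro x hx
    obtain ⟨j, hj⟩ := mem_frequentVisits.1 hx
    obtain ⟨n, hn⟩ := hj.exists
    refine Set.mem_iUnion.2 ⟨n, n, le_rfl, lt_of_le_of_lt ?_ hn⟩
    gcongr
    have : (0 : ℝ) ≤ 1 / ((j : ℝ) + 1) := by positivity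
    linarith
  calc ENNReal.ofReal a * μ (frequentVisits T A a)
      ≤ ENNReal.ofReal a * μ (⋃ n, B n) := by gcongr
    _ = ⨆ n, ENNReal.ofReal a * μ (B n) := by rw [hmono.measure_iUnion, ENNReal.mul_iSup]
    _ ≤ μ A := iSup_le fun n => mul_measure_exists_le_visits_gt_le hT hA hμA ha n

end Maximal

/-! ### Birkhoff's theorem for indicators -/

section Ergodic

variable {X : Type*} [MeasurableSpace X] {μ : Measure X} [IsProbabilityMeasure μ] {T : X → X}
  {A : Set X}

theorem Ergodic.measure_frequentVisits_eq_zero (hT : Ergodic T μ) (hA : MeasurableSet A) {a : ℝ}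
    (ha : μ.real A < a) : μ (frequentVisits T A a) = 0 := by
  refine (hT.toPreErgodic.prob_eq_zero_or_one
    (measurableSet_frequentVisits hT.measurable hA a)
    (preimage_frequentVisits T A a)).resolve_right fun h1 => ?_
  have h := mul_measure_frequentVisits_le hT.toMeasurePreserving hA (measure_ne_top μ A)
    (measureReal_nonneg.trans_lt ha)
  rw [h1, mul_one, ENNReal.ofReal_le_iff_le_toReal (measure_ne_top μ A)] at h
  exact absurd ha (not_lt.2 h)

theorem Ergodic.ae_eventually_visits_le (hT : Ergodic T μ) (hA : MeasurableSet A) :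
    ∀ᵐ x ∂μ, ∀ b : ℝ, μ.real A < b → ∀ᶠ n : ℕ in atTop, visits T A n x ≤ b * n := by
  have h : ∀ j : ℕ, ∀ᵐ x ∂μ, x ∉ frequentVisits T A (μ.real A + 1 / ((j : ℝ) + 1)) := fun j =>
    measure_eq_zero_iff_ae_notMem.1 (hT.measure_frequentVisits_eq_zero hA (by
      have : (0 : ℝ) < 1 / ((j : ℝ) + 1) := by positivity
      linarith))
  filter_upwards [ae_all_iff.2 h] with x hx b hb
  obtain ⟨j, hj⟩ := exists_nat_one_div_lt (sub_pos.2 hb)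
  exact eventually_visits_le (by linarith) (hx j)

/-- Birkhoff's ergodic theorem for the indicator function of a set. -/
theorem Ergodic.ae_tendsto_visits_div (hT : Ergodic T μ) (hA : MeasurableSet A) :
    ∀ᵐ x ∂μ, Tendsto (fun n : ℕ => visits T A n x / n) atTop (𝓝 (μ.real A)) := by
  -- The upper bound for the complement is the lower bound for `A`.
  filter_upwards [hT.ae_eventually_visits_le hA, hT.ae_eventually_visits_le hA.compl]
    with x h1 h2
  rw [tendsto_order]
  refine ⟨fun b hb => ?_, fun b hb => ?_⟩
  · obtain ⟨c, hbc, hc⟩ := exists_between hb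
    have hcompl : μ.real Aᶜ < 1 - c := by
      rw [probReal_compl_eq_one_sub hA]; linarith
    filter_upwards [h2 _ hcompl, eventually_gt_atTop 0] with n hn hn0
    have hn' : (0 : ℝ) < n := Nat.cast_pos.2 hn0
    rw [lt_div_iff₀ hn']
    have := visits_add_visits_compl (T := T) (A := A) n x
    nlinarith
  · obtain ⟨c, hc, hcb⟩ := exists_between hb
    filter_upwards [h1 _ hc, eventually_gt_atTop 0] with n hn hn0
    have hn' : (0 : ℝ) < n := Nat.cast_pos.2 hn0
    rw [div_lt_iff₀ hn']
    nlinarith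

end Ergodic

/-! ### The skew product -/

/-- The skew product over `T` with cocycle `f`. -/
def skewProduct {X G : Type*} [Add G] (T : X → X) (f : X → G) (p : X × G) : X × G :=
  (T p.1, p.2 + f p.1)

section SkewProduct

variable {X G : Type*} [AddCommGroup G] {T : X → X} {f : X → G}

theorem iterate_skewProduct (n : ℕ) (p : X × G) :
    (skewProduct T f)^[n] p = (T^[n] p.1, p.2 + birkhoffSum T f n p.1) := by
  induction n with
  | zero => simp
  | succ n ih =>
    rw [Function.iterate_succ_apply', ih, Function.iterate_succ_apply', birkhoffSum_succ,
      skewProduct, add_assoc]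

theorem visits_skewProduct_eq_card [DecidableEq G] (n : ℕ) (x : X) :
    visits (skewProduct T f) (Set.univ ×ˢ {0}) n (x, 0) =
      ((Finset.range n).filter fun k => birkhoffSum T f k x = 0).card := by
  classical
  rw [visits_eq_card]
  congr 2
  ext k
  simp [iterate_skewProduct]

variable [MeasurableSpace X] [MeasurableSpace G] [Countable G] [MeasurableSingletonClass G]
  {μ : Measure X} [SFinite μ]

theorem measurePreserving_skewProduct (hT : MeasurePreserving T μ μ) (hf : Measurable f) :
    MeasurePreserving (skewProduct T f) (μ.prod .count) (μ.prod .count) := by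
  refine hT.skew_product (g := fun x z => z + f x)
    (measurable_snd.add (hf.comp measurable_fst)) (ae_of_all _ fun x => ?_)
  exact map_add_right_eq_self _ _

end SkewProduct

/-! ### Averaging a sublinear count along orbits -/

section DoubleAverage

variable {X : Type*} [MeasurableSpace X] {μ : Measure X} [IsProbabilityMeasure μ] {T : X → X}

/-- As in Egorov's theorem, the exceptional sets decrease in `N` to a null set. -/
theorem exists_measureReal_exists_ge_lt {u : ℕ → X → ℝ} (hum : ∀ n, Measurable (u n))
    (h : ∀ᵐ x ∂μ, Tendsto (fun n : ℕ => u n x / n) atTop (𝓝 0)) {ε : ℝ} (hε : 0 < ε) :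
    ∃ N, MeasurableSet {x | ∃ n ≥ N, ε * n < u n x} ∧
      μ.real {x | ∃ n ≥ N, ε * n < u n x} < ε := by
  set B : ℕ → Set X := fun N => {x | ∃ n ≥ N, ε * n < u n x}
  have hB : ∀ N, MeasurableSet (B N) := fun N => by
    have : B N = ⋃ n, ⋃ _ : n ≥ N, {x | ε * n < u n x} := by ext; simp [B]
    rw [this]
    exact MeasurableSet.iUnion fun n => MeasurableSet.iUnion fun _ =>
      measurableSet_lt measurable_const (hum n)
  have hanti : Antitone B := fun M N hMN x ⟨n, hn, hx⟩ => ⟨n, hMN.trans hn, hx⟩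
  have hnull : μ (⋂ N, B N) = 0 := by
    rw [measure_eq_zero_iff_ae_notMem]
    filter_upwards [h] with x hx hmem
    obtain ⟨N, hN⟩ := eventually_atTop.1
      ((hx.eventually_lt_const hε).and (eventually_gt_atTop 0))
    obtain ⟨n, hn, hlt⟩ := Set.mem_iInter.1 hmem N
    have h1 := hN n hn
    rw [div_lt_iff₀ (Nat.cast_pos.2 h1.2)] at h1
    exact absurd h1.1 (not_lt.2 hlt.le)
  have hlim := tendsto_measure_iInter_atTop (μ := μ) (fun N => (hB N).nullMeasurableSet) hanti
    ⟨0, measure_ne_top _ _⟩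
  rw [hnull] at hlim
  obtain ⟨N, hN⟩ := (hlim.eventually_lt_const (ENNReal.ofReal_pos.2 hε)).exists
  refine ⟨N, hB N, ?_⟩
  exact (ENNReal.lt_ofReal_iff_toReal_lt (measure_ne_top _ _)).1 hN

/-- For large `n`, `u n ≤ ε n` off a set `B` of measure below `ε`, and `u n ≤ n` on `B`. By
Birkhoff's theorem the orbit meets `B` fewer than `ε n` times, so the sum is below `2 ε n²`. -/
theorem Ergodic.ae_tendsto_sum_iterate_div_sq (hT : Ergodic T μ) {u : ℕ → X → ℝ}
    (hum : ∀ n, Measurable (u n)) (hu0 : ∀ n x, 0 ≤ u n x) (hun : ∀ n x, u n x ≤ n)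
    (h : ∀ᵐ x ∂μ, Tendsto (fun n : ℕ => u n x / n) atTop (𝓝 0)) :
    ∀ᵐ x ∂μ, Tendsto (fun n : ℕ => (∑ i ∈ Finset.range n, u n (T^[i] x)) / (n : ℝ) ^ 2)
      atTop (𝓝 0) := by
  have hN : ∀ j : ℕ, ∃ N, MeasurableSet {x | ∃ n ≥ N, 1 / ((j : ℝ) + 1) * n < u n x} ∧
      μ.real {x | ∃ n ≥ N, 1 / ((j : ℝ) + 1) * n < u n x} < 1 / ((j : ℝ) + 1) := fun j =>
    exists_measureReal_exists_ge_lt hum h (by positivity)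
  choose N hNm hN using hN
  filter_upwards [ae_all_iff.2 fun j => hT.ae_tendsto_visits_div (hNm j)] with x hx
  rw [tendsto_order]
  refine ⟨fun b hb => Eventually.of_forall fun n => hb.trans_le
    (div_nonneg (Finset.sum_nonneg fun _ _ => hu0 _ _) (sq_nonneg _)), fun b hb => ?_⟩
  obtain ⟨j, hj⟩ := exists_nat_one_div_lt (half_pos hb)
  set ε : ℝ := 1 / ((j : ℝ) + 1)
  filter_upwards [(hx j).eventually_lt_const (hN j), eventually_ge_atTop (N j),
    eventually_gt_atTop 0] with n hn hnN hn0
  have hn' : (0 : ℝ) < n := Nat.cast_pos.2 hn0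
  rw [div_lt_iff₀ hn'] at hn
  rw [div_lt_iff₀ (by positivity)]
  set B := {x | ∃ n ≥ N j, ε * n < u n x}
  have hε : 0 < ε := by positivity
  have hpt : ∀ y, u n y ≤ ε * n + n * B.indicator (fun _ => (1 : ℝ)) y := by
    intro y
    by_cases hy : y ∈ B
    · rw [Set.indicator_of_mem hy]
      have := hun n y
      nlinarith
    · rw [Set.indicator_of_notMem hy, mul_zero, add_zero]
      by_contra hcon
      exact hy ⟨n, hnN, not_le.1 hcon⟩
  calc ∑ i ∈ Finset.range n, u n (T^[i] x)
      ≤ ∑ i ∈ Finset.range n, (ε * n + n * B.indicator (fun _ => (1 : ℝ)) (T^[i] x)) :=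
        Finset.sum_le_sum fun i _ => hpt _
    _ = n * (ε * n) + n * visits T B n x := by
        rw [Finset.sum_add_distrib, Finset.sum_const, Finset.card_range, nsmul_eq_mul, visits,
          birkhoffSum, Finset.mul_sum]
    _ < b * (n : ℝ) ^ 2 := by nlinarith

end DoubleAverage

/-! ### Self-intersections, transfer functions and the non-coboundary case -/

section SelfIntersections

variable {X : Type*} {d : ℕ} {T : X → X} {f : X → Fin d → ℤ}

theorem selfIntersections_le (n : ℕ) (x : X) : (selfIntersections T f n x : ℝ) ≤
    2 * ∑ i ∈ Finset.range n,
      visits (skewProduct T f) (Set.univ ×ˢ {0}) n (T^[i] (T x), 0) := by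
  set P := ((Finset.Icc 1 n) ×ˢ (Finset.Icc 1 n)).filter
    fun p : ℕ × ℕ => birkhoffSum T f p.1 x = birkhoffSum T f p.2 x
  set Q := P.filter fun p : ℕ × ℕ => p.1 ≤ p.2
  set R : Finset (Σ _ : ℕ, ℕ) := (Finset.range n).sigma fun i =>
    (Finset.range n).filter fun k => birkhoffSum T f k (T^[i] (T x)) = 0
  have hQR : Q.card ≤ R.card := by
    -- A coincidence at times `j ≤ k` is a return to `0` after `k - j` steps from `T^j x`; since `j`
    -- starts at `1`, the base point is `T x` and the index is `j - 1`.
    refine Finset.card_le_card_of_injOn (fun p => ⟨p.1 - 1, p.2 - p.1⟩) ?_ ?_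
    · rintro ⟨j, k⟩ hjk
      simp only [Q, P, Finset.coe_filter, Finset.mem_filter, Finset.mem_product, Finset.mem_Icc,
        Set.mem_ofPred_eq] at hjk
      obtain ⟨⟨⟨⟨hj1, hjn⟩, hk1, hkn⟩, heq⟩, hle⟩ := hjk
      simp only [R, Finset.mem_coe, Finset.mem_sigma, Finset.mem_range, Finset.mem_filter]
      refine ⟨by omega, by omega, ?_⟩
      rw [← Function.iterate_succ_apply, show (j - 1).succ = j by omega]
      have := birkhoffSum_add T f j (k - j) x
      rw [Nat.add_sub_cancel' hle, ← heq] at this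
      simpa using this
    · rintro ⟨j, k⟩ hjk ⟨j', k'⟩ hjk' h
      simp only [Q, P, Finset.coe_filter, Finset.mem_filter, Finset.mem_product, Finset.mem_Icc,
        Set.mem_ofPred_eq] at hjk hjk'
      simp only [Sigma.mk.injEq, heq_eq_eq] at h
      simp only [Prod.mk.injEq]
      omega
  have hPQ : P.card ≤ 2 * Q.card := by
    have hsub : P ⊆ Q ∪ Q.image Prod.swap := by
      rintro ⟨j, k⟩ hjk
      rcases le_total j k with hle | hle
      · exact Finset.mem_union_left _ (Finset.mem_filter.2 ⟨hjk, hle⟩)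
      · refine Finset.mem_union_right _ (Finset.mem_image.2 ⟨(k, j), ?_, rfl⟩)
        simp only [Q, P, Finset.mem_filter, Finset.mem_product] at hjk ⊢
        exact ⟨⟨⟨hjk.1.2, hjk.1.1⟩, hjk.2.symm⟩, hle⟩
    calc P.card ≤ _ := Finset.card_le_card hsub
      _ ≤ Q.card + (Q.image Prod.swap).card := Finset.card_union_le _ _
      _ ≤ 2 * Q.card := by have := Finset.card_image_le (s := Q) (f := Prod.swap); omega
  simp only [visits_skewProduct_eq_card]
  have : P.card ≤ 2 * R.card := by omega
  rw [Finset.card_sigma] at this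
  exact_mod_cast this

variable [MeasurableSpace X] {μ : Measure X}

/-- A real transfer function of an integer valued coboundary yields an integer valued one. -/
theorem IsCoboundary.exists_int (h : IsCoboundary μ T f) :
    ∃ Ψ : X → Fin d → ℤ, Measurable Ψ ∧ ∀ᵐ x ∂μ, Ψ (T x) = Ψ x + f x := by
  obtain ⟨Φ, hΦ, h⟩ := h
  -- The floor commutes with adding the integer `f x i`.
  refine ⟨fun x i => ⌊Φ x i⌋, measurable_pi_lambda _ fun i =>
    Int.measurable_floor.comp ((measurable_pi_apply i).comp hΦ), ?_⟩
  filter_upwards [h] with x hx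
  funext i
  have : Φ (T x) i = Φ x i + (f x i : ℝ) := by rw [hx i]; ring
  simp [this]

theorem ae_birkhoffSum_eq_iff_of_transfer (hT : MeasurePreserving T μ μ) {Ψ : X → Fin d → ℤ}
    (h : ∀ᵐ x ∂μ, Ψ (T x) = Ψ x + f x) : ∀ᵐ x ∂μ, ∀ j k : ℕ,
      birkhoffSum T f j x = birkhoffSum T f k x ↔ Ψ (T^[j] x) = Ψ (T^[k] x) := by
  have hall : ∀ᵐ x ∂μ, ∀ n : ℕ, Ψ (T (T^[n] x)) = Ψ (T^[n] x) + f (T^[n] x) :=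
    ae_all_iff.2 fun n => (hT.iterate n).quasiMeasurePreserving.ae h
  filter_upwards [hall] with x hx j k
  have key : ∀ n : ℕ, Ψ (T^[n] x) = Ψ x + birkhoffSum T f n x := by
    intro n
    induction n with
    | zero => simp
    | succ n ih => rw [Function.iterate_succ_apply', hx, ih, birkhoffSum_succ, add_assoc]
  rw [key, key, add_right_inj]

variable [IsProbabilityMeasure μ]

/-- The barycentre of the fibres of an invariant set of finite measure is a transfer function. -/
theorem isCoboundary_of_preimage_skewProduct_eq (hT : Ergodic T μ)
    {E : Set (X × (Fin d → ℤ))} (hE : MeasurableSet E) (hinv : skewProduct T f ⁻¹' E = E)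
    (h0 : μ.prod .count E ≠ 0) (htop : μ.prod .count E ≠ ⊤) : IsCoboundary μ T f := by
  have hmem : ∀ x z, (T x, z + f x) ∈ E ↔ (x, z) ∈ E := fun x z => by
    conv_rhs => rw [← hinv]
    rfl
  set N : X → ENNReal := fun x => Measure.count (Prod.mk x ⁻¹' E)
  have hNm : Measurable N := measurable_measure_prodMk_left hE
  -- The fibre over `T x` is the fibre over `x` translated by `f x`, so ergodicity makes the fibre
  -- cardinality a constant `c`.
  have hNT : N ∘ T = N := by
    funext x
    have : Prod.mk x ⁻¹' E = (fun z => z + f x) ⁻¹' (Prod.mk (T x) ⁻¹' E) := by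
      ext z; exact (hmem x z).symm
    simp only [N, Function.comp_apply]
    rw [this, measure_preimage_add_right]
  obtain ⟨c, hc⟩ := hT.toPreErgodic.ae_eq_const_of_ae_eq_comp hNm hNT
  have hlint : μ.prod .count E = c := by
    rw [Measure.prod_apply hE, lintegral_congr_ae hc]; simp
  rw [hlint] at h0 htop
  set F : X → Fin d → ℝ := fun x i =>
    ∫ z, E.indicator (fun p : X × (Fin d → ℤ) => (p.2 i : ℝ)) (x, z) ∂Measure.count
  have hgm : ∀ i, Measurable (E.indicator fun p : X × (Fin d → ℤ) => (p.2 i : ℝ)) := fun i =>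
    Measurable.indicator (by fun_prop) hE
  have hFm : Measurable F := measurable_pi_lambda _ fun i =>
    (hgm i).stronglyMeasurable.integral_prod_right'.measurable
  refine ⟨fun x => c.toReal⁻¹ • F x, hFm.const_smul c.toReal⁻¹, ?_⟩
  filter_upwards [hc] with x hx i
  have hx' : Measure.count (Prod.mk x ⁻¹' E) = c := hx
  have hfin : (Prod.mk x ⁻¹' E).Finite := Measure.count_apply_lt_top.1 (by
    rw [hx']; exact htop.lt_top)
  have hint : ∀ h : (Fin d → ℤ) → ℝ,
      Integrable ((Prod.mk x ⁻¹' E).indicator h) Measure.count := fun h => by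
    rw [integrable_count_iff]
    exact summable_of_hasFiniteSupport (hfin.subset fun z hz => by
      by_contra hcon
      exact hz (by simp [Set.indicator_of_notMem hcon]))
  have hFx : F x i = ∫ z, (Prod.mk x ⁻¹' E).indicator (fun z => (z i : ℝ)) z ∂Measure.count := rfl
  -- Each of the `c` points of the fibre moves by `f x`; dividing by `c` gives the transfer
  -- function.
  have hshift : F (T x) i = F x i + (f x i : ℝ) * c.toReal := by
    calc F (T x) i
        = ∫ z, E.indicator (fun p : X × (Fin d → ℤ) => (p.2 i : ℝ)) (T x, z + f x)
            ∂Measure.count := (integral_add_right_eq_self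
              (fun z => E.indicator (fun p : X × (Fin d → ℤ) => (p.2 i : ℝ)) (T x, z)) _).symm
      _ = ∫ z, ((Prod.mk x ⁻¹' E).indicator (fun z => (z i : ℝ)) z +
            (Prod.mk x ⁻¹' E).indicator (fun _ => (f x i : ℝ)) z) ∂Measure.count := by
          congr 1
          funext z
          by_cases hz : (x, z) ∈ E
          · have hz1 : z ∈ Prod.mk x ⁻¹' E := hz
            rw [Set.indicator_of_mem ((hmem x z).2 hz), Set.indicator_of_mem hz1,
              Set.indicator_of_mem hz1]
            simp
          · have hz1 : z ∉ Prod.mk x ⁻¹' E := hz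
            rw [Set.indicator_of_notMem (mt (hmem x z).1 hz), Set.indicator_of_notMem hz1,
              Set.indicator_of_notMem hz1, add_zero]
      _ = F x i + (f x i : ℝ) * c.toReal := by
          rw [integral_add (hint _) (hint _), ← hFx,
            integral_indicator (measurable_prodMk_left hE), setIntegral_const, measureReal_def,
            hx', smul_eq_mul, mul_comm]
  have hcne : c.toReal ≠ 0 := (ENNReal.toReal_pos h0 htop).ne'
  simp only [Pi.smul_apply, smul_eq_mul, hshift]
  field_simp
  ring

theorem ae_tendsto_visits_skewProduct_div (hT : Ergodic T μ) (hf : Measurable f)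
    (hcob : ¬ IsCoboundary μ T f) :
    ∀ᵐ x ∂μ, Tendsto (fun n : ℕ =>
      visits (skewProduct T f) (Set.univ ×ˢ {0}) n (x, 0) / n) atTop (𝓝 0) := by
  have hS := measurePreserving_skewProduct hT.toMeasurePreserving hf
  set A : Set (X × (Fin d → ℤ)) := Set.univ ×ˢ {0}
  have hA : MeasurableSet A := MeasurableSet.univ.prod (measurableSet_singleton _)
  have hμA : μ.prod .count A = 1 := by
    rw [Measure.prod_prod, measure_univ, Measure.count_singleton, one_mul]
  have hnull : ∀ j : ℕ, ∀ᵐ x ∂μ,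
      (x, 0) ∉ frequentVisits (skewProduct T f) A (1 / ((j : ℝ) + 1)) := fun j => by
    have hpos : (0 : ℝ) < 1 / ((j : ℝ) + 1) := by positivity
    have hmeas := measurableSet_frequentVisits hS.measurable hA (1 / ((j : ℝ) + 1))
    have hle := mul_measure_frequentVisits_le hS hA (by simp [hμA]) hpos
    have hzero : μ.prod .count (frequentVisits (skewProduct T f) A (1 / ((j : ℝ) + 1))) = 0 := by
      by_contra h0
      refine hcob (isCoboundary_of_preimage_skewProduct_eq hT hmeas
        (preimage_frequentVisits _ _ _) h0 fun htop => ?_)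
      rw [htop, ENNReal.mul_top (ENNReal.ofReal_pos.2 hpos).ne', hμA] at hle
      exact absurd hle (by simp)
    -- Counting measure charges every point, so a null set of the product misses `(x, 0)` for almost
    -- every `x`.
    have := Measure.ae_ae_of_ae_prod (measure_eq_zero_iff_ae_notMem.1 hzero)
    filter_upwards [this] with x hx
    exact Measure.ae_count_iff.1 hx 0
  filter_upwards [ae_all_iff.2 hnull] with x hx
  rw [tendsto_order]
  refine ⟨fun b hb => Eventually.of_forall fun n => hb.trans_le
    (div_nonneg (visits_nonneg _ _) n.cast_nonneg), fun b hb => ?_⟩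
  obtain ⟨c, hc, hcb⟩ := exists_between hb
  obtain ⟨j, hj⟩ := exists_nat_one_div_lt hc
  filter_upwards [eventually_visits_le hj (hx j), eventually_gt_atTop 0] with n hn hn0
  have hn' : (0 : ℝ) < n := Nat.cast_pos.2 hn0
  rw [div_lt_iff₀ hn']
  nlinarith

theorem ae_tendsto_selfIntersections_of_not_isCoboundary (hT : Ergodic T μ) (hf : Measurable f)
    (hcob : ¬ IsCoboundary μ T f) :
    ∀ᵐ x ∂μ, Tendsto (fun n : ℕ => (selfIntersections T f n x : ℝ) / (n : ℝ) ^ 2)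
      atTop (𝓝 0) := by
  have hS := measurePreserving_skewProduct hT.toMeasurePreserving hf
  have h := hT.ae_tendsto_sum_iterate_div_sq
    (u := fun n x => visits (skewProduct T f) (Set.univ ×ˢ {0}) n (x, 0))
    (fun n => (measurable_visits hS.measurable
      (MeasurableSet.univ.prod (measurableSet_singleton _)) n).comp measurable_prodMk_right)
    (fun n x => visits_nonneg _ _) (fun n x => visits_le _ _)
    (ae_tendsto_visits_skewProduct_div hT hf hcob)
  filter_upwards [hT.toMeasurePreserving.quasiMeasurePreserving.ae h] with x hx
  refine squeeze_zero (fun n => by positivity) (fun n => ?_) (by simpa using hx.const_mul 2)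
  rw [← mul_div_assoc]
  gcongr
  exact selfIntersections_le n x

end SelfIntersections

/-! ### Counting coincidences by value -/

section Coincidences

variable {ι : Type*} [DecidableEq ι]

/-- Coincidences with value in `F` contribute exactly the sum of squares; any other has its first
index among those with value outside `F`, its second arbitrary. The second bound is rearranged to
avoid subtraction in `ℕ`. -/
theorem sum_sq_card_fiber_le_card_coincidences (s : Finset ℕ) (ψ : ℕ → ι) (F : Finset ι) :
    ∑ y ∈ F, (s.filter fun k => ψ k = y).card ^ 2 ≤
      ((s ×ˢ s).filter fun p : ℕ × ℕ => ψ p.1 = ψ p.2).card ∧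
    ((s ×ˢ s).filter fun p : ℕ × ℕ => ψ p.1 = ψ p.2).card +
        (∑ y ∈ F, (s.filter fun k => ψ k = y).card) * s.card ≤
      ∑ y ∈ F, (s.filter fun k => ψ k = y).card ^ 2 + s.card * s.card := by
  set P := (s ×ˢ s).filter fun p : ℕ × ℕ => ψ p.1 = ψ p.2
  have h1 : (P.filter fun p => ψ p.1 ∈ F).card =
      ∑ y ∈ F, (s.filter fun k => ψ k = y).card ^ 2 := by
    have hmaps : ∀ p ∈ P.filter fun p => ψ p.1 ∈ F, ψ p.1 ∈ F := fun p hp =>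
      (Finset.mem_filter.1 hp).2
    rw [Finset.card_eq_sum_card_fiberwise hmaps]
    refine Finset.sum_congr rfl fun y hy => ?_
    rw [sq, ← Finset.card_product]
    congr 1
    ext ⟨j, k⟩
    simp only [P, Finset.mem_filter, Finset.mem_product]
    constructor
    · rintro ⟨⟨⟨⟨hj, hk⟩, hjk⟩, -⟩, rfl⟩
      exact ⟨⟨hj, rfl⟩, hk, hjk.symm⟩
    · rintro ⟨⟨hj, rfl⟩, hk, hjk⟩
      exact ⟨⟨⟨⟨hj, hk⟩, hjk.symm⟩, hy⟩, rfl⟩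
  have h2 : (s.filter fun k => ψ k ∈ F).card = ∑ y ∈ F, (s.filter fun k => ψ k = y).card := by
    have hmaps : ∀ k ∈ s.filter fun k => ψ k ∈ F, ψ k ∈ F := fun k hk =>
      (Finset.mem_filter.1 hk).2
    rw [Finset.card_eq_sum_card_fiberwise hmaps]
    refine Finset.sum_congr rfl fun y hy => ?_
    congr 1
    ext k
    simp only [Finset.mem_filter]
    constructor
    · rintro ⟨⟨hk, -⟩, h⟩; exact ⟨hk, h⟩
    · rintro ⟨hk, rfl⟩; exact ⟨⟨hk, hy⟩, rfl⟩
  have h3 : (P.filter fun p => ψ p.1 ∉ F).card ≤ (s.filter fun k => ψ k ∉ F).card * s.card := by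
    rw [← Finset.card_product]
    refine Finset.card_le_card ?_
    rintro ⟨j, k⟩ hjk
    simp only [P, Finset.mem_filter, Finset.mem_product] at hjk ⊢
    exact ⟨⟨hjk.1.1.1, hjk.2⟩, hjk.1.1.2⟩
  have h4 := Finset.card_filter_add_card_filter_not (s := P) fun p => ψ p.1 ∈ F
  have h5 := Finset.card_filter_add_card_filter_not (s := s) fun k => ψ k ∈ F
  refine ⟨by omega, ?_⟩
  rw [← h1, ← h2]
  nlinarith

end Coincidences

/-! ### The limit for coboundaries -/

section Coboundary

variable {X : Type*} [MeasurableSpace X] {μ : Measure X} [IsProbabilityMeasure μ] {T : X → X}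
  {d : ℕ} {f : X → Fin d → ℤ} {ι : Type*} [Countable ι] [MeasurableSpace ι]
  [MeasurableSingletonClass ι]

theorem hasSum_measureReal_fiber {Ψ : X → ι} (hΨ : Measurable Ψ) :
    HasSum (fun y => μ.real (Ψ ⁻¹' {y})) 1 := by
  have h : ∑' y, μ (Ψ ⁻¹' {y}) = 1 := by
    rw [← measure_iUnion (fun y z hyz => Disjoint.preimage _ (by simpa using hyz))
      (fun y => hΨ (measurableSet_singleton y)), ← Set.preimage_iUnion,
      Set.iUnion_of_singleton, Set.preimage_univ, measure_univ]
  have := ENNReal.hasSum_toReal (f := fun y => μ (Ψ ⁻¹' {y})) (by simp [h])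
  rw [← ENNReal.tsum_toReal_eq (fun y => measure_ne_top _ _), h] at this
  exact this

/-- A finite set `F` of values replaces the interchange of limit and infinite sum: the values
outside `F` cost at most their total frequency, which tends to a tail of a convergent series. -/
theorem ae_tendsto_selfIntersections_of_transfer (hT : Ergodic T μ) {Ψ : X → Fin d → ℤ}
    (hΨ : Measurable Ψ) (h : ∀ᵐ x ∂μ, Ψ (T x) = Ψ x + f x) :
    ∀ᵐ x ∂μ, Tendsto (fun n : ℕ => (selfIntersections T f n x : ℝ) / (n : ℝ) ^ 2)
      atTop (𝓝 (∑' y, μ.real (Ψ ⁻¹' {y}) ^ 2)) := by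
  have hvis : ∀ᵐ x ∂μ, ∀ y, Tendsto (fun n : ℕ => visits T (Ψ ⁻¹' {y}) n (T x) / n) atTop
      (𝓝 (μ.real (Ψ ⁻¹' {y}))) := ae_all_iff.2 fun y =>
    hT.toMeasurePreserving.quasiMeasurePreserving.ae
      (hT.ae_tendsto_visits_div (hΨ (measurableSet_singleton y)))
  have hsum := hasSum_measureReal_fiber (μ := μ) hΨ
  have hsq : Summable fun y => μ.real (Ψ ⁻¹' {y}) ^ 2 :=
    Summable.of_nonneg_of_le (fun y => sq_nonneg _) (fun y => by
      have h1 := measureReal_nonneg (μ := μ) (s := Ψ ⁻¹' {y})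
      have h2 := measureReal_le_one (μ := μ) (s := Ψ ⁻¹' {y})
      nlinarith) hsum.summable
  filter_upwards [hvis, ae_birkhoffSum_eq_iff_of_transfer hT.toMeasurePreserving h]
    with x hx hiff
  set N : ℕ → (Fin d → ℤ) → ℕ := fun n y =>
    ((Finset.Icc 1 n).filter fun k => Ψ (T^[k] x) = y).card
  have hN : ∀ n y, visits T (Ψ ⁻¹' {y}) n (T x) = N n y := by
    intro n y
    classical
    rw [visits_eq_card]
    congr 1
    refine Finset.card_bij (fun k _ => k + 1) ?_ (by simp) ?_
    · intro k hk
      simp only [Finset.mem_filter, Finset.mem_range, Set.mem_preimage,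
        Set.mem_singleton_iff] at hk
      simp only [Finset.mem_filter, Finset.mem_Icc, Function.iterate_succ_apply]
      exact ⟨by omega, hk.2⟩
    · intro k hk
      simp only [Finset.mem_filter, Finset.mem_Icc] at hk
      refine ⟨k - 1, ?_, by omega⟩
      simp only [Finset.mem_filter, Finset.mem_range, Set.mem_preimage,
        Set.mem_singleton_iff]
      refine ⟨by omega, ?_⟩
      rw [← Function.iterate_succ_apply, show (k - 1).succ = k by omega]
      exact hk.2
  simp only [hN] at hx
  have hV : ∀ n, selfIntersections T f n x = (((Finset.Icc 1 n) ×ˢ (Finset.Icc 1 n)).filter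
      fun p : ℕ × ℕ => Ψ (T^[p.1] x) = Ψ (T^[p.2] x)).card := by
    intro n
    rw [selfIntersections]
    congr 1
    exact Finset.filter_congr fun p _ => hiff p.1 p.2
  have hlim2 : ∀ F : Finset (Fin d → ℤ), Tendsto (fun n : ℕ => ∑ y ∈ F, ((N n y : ℝ) / n) ^ 2)
      atTop (𝓝 (∑ y ∈ F, μ.real (Ψ ⁻¹' {y}) ^ 2)) := fun F =>
    tendsto_finsetSum _ fun y _ => (hx y).pow 2
  have hlim1 : ∀ F : Finset (Fin d → ℤ), Tendsto (fun n : ℕ => ∑ y ∈ F, (N n y : ℝ) / n)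
      atTop (𝓝 (∑ y ∈ F, μ.real (Ψ ⁻¹' {y}))) := fun F =>
    tendsto_finsetSum _ fun y _ => hx y
  have hbound : ∀ (F : Finset (Fin d → ℤ)) (n : ℕ), 0 < n →
      ∑ y ∈ F, ((N n y : ℝ) / n) ^ 2 ≤ (selfIntersections T f n x : ℝ) / (n : ℝ) ^ 2 ∧
      (selfIntersections T f n x : ℝ) / (n : ℝ) ^ 2 ≤
        ∑ y ∈ F, ((N n y : ℝ) / n) ^ 2 + (1 - ∑ y ∈ F, (N n y : ℝ) / n) := by
    intro F n hn0
    have hn' : (0 : ℝ) < n := Nat.cast_pos.2 hn0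
    have hc := sum_sq_card_fiber_le_card_coincidences (Finset.Icc 1 n) (fun k => Ψ (T^[k] x)) F
    simp only [← hV, Nat.card_Icc, Nat.add_sub_cancel] at hc
    obtain ⟨h1, h2⟩ := hc
    have h1' : ∑ y ∈ F, (N n y : ℝ) ^ 2 ≤ selfIntersections T f n x := by exact_mod_cast h1
    have h2' : (selfIntersections T f n x : ℝ) + (∑ y ∈ F, (N n y : ℝ)) * n ≤
        ∑ y ∈ F, (N n y : ℝ) ^ 2 + n * n := by exact_mod_cast h2
    simp only [div_pow, ← Finset.sum_div]
    refine ⟨by gcongr, ?_⟩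
    rw [div_le_iff₀ (by positivity)]
    have : (((∑ y ∈ F, (N n y : ℝ) ^ 2) / (n : ℝ) ^ 2) + (1 - (∑ y ∈ F, (N n y : ℝ)) / n)) *
        (n : ℝ) ^ 2 = ∑ y ∈ F, (N n y : ℝ) ^ 2 + n * n - (∑ y ∈ F, (N n y : ℝ)) * n := by
      field_simp
      ring
    linarith
  rw [tendsto_order]
  constructor
  · intro b hb
    obtain ⟨F, hF⟩ := (hsq.hasSum.eventually_const_lt hb).exists
    filter_upwards [(hlim2 F).eventually_const_lt hF, eventually_gt_atTop 0] with n hn hn0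
    exact hn.trans_le (hbound F n hn0).1
  · intro b hb
    have hup : Tendsto (fun F : Finset (Fin d → ℤ) => ∑ y ∈ F, μ.real (Ψ ⁻¹' {y}) ^ 2 +
        (1 - ∑ y ∈ F, μ.real (Ψ ⁻¹' {y}))) atTop (𝓝 (∑' y, μ.real (Ψ ⁻¹' {y}) ^ 2)) := by
      simpa using Tendsto.add hsq.hasSum (Tendsto.const_sub 1 hsum)
    obtain ⟨F, hF⟩ := (hup.eventually_lt_const hb).exists
    filter_upwards [((hlim2 F).add ((hlim1 F).const_sub 1)).eventually_lt_const hF,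
      eventually_gt_atTop 0] with n hn hn0
    exact (hbound F n hn0).2.trans_lt hn

theorem tsum_measureReal_fiber_sq_pos {Ψ : X → ι} (hΨ : Measurable Ψ) :
    0 < ∑' y, μ.real (Ψ ⁻¹' {y}) ^ 2 := by
  have hsum := hasSum_measureReal_fiber (μ := μ) hΨ
  have hsq : Summable fun y => μ.real (Ψ ⁻¹' {y}) ^ 2 :=
    Summable.of_nonneg_of_le (fun y => sq_nonneg _) (fun y => by
      have h1 := measureReal_nonneg (μ := μ) (s := Ψ ⁻¹' {y})
      have h2 := measureReal_le_one (μ := μ) (s := Ψ ⁻¹' {y})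
      nlinarith) hsum.summable
  obtain ⟨y, hy⟩ : ∃ y, μ.real (Ψ ⁻¹' {y}) ≠ 0 := by
    by_contra! hcon
    simp only [hcon] at hsum
    exact zero_ne_one (hasSum_zero.unique hsum)
  exact hsq.tsum_pos (fun y => sq_nonneg _) y (by positivity)

end Coboundary

theorem mainTheorem7 {X : Type*} [MeasurableSpace X] (μ : Measure X) [IsProbabilityMeasure μ]
    (T : X → X) (hT : Ergodic T μ) (d : ℕ) (hd : 1 ≤ d) (f : X → Fin d → ℤ) (hf : Measurable f) :
    ∃ β : ℝ, 0 ≤ β ∧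
      (∀ᵐ x ∂μ, Tendsto (fun n : ℕ => (selfIntersections T f n x : ℝ) / (n : ℝ) ^ 2)
        atTop (𝓝 β)) ∧
      (0 < β ↔ IsCoboundary μ T f) := by
  by_cases hcob : IsCoboundary μ T f
  · obtain ⟨Ψ, hΨ, h⟩ := hcob.exists_int
    have hpos := tsum_measureReal_fiber_sq_pos (μ := μ) hΨ
    exact ⟨_, hpos.le, ae_tendsto_selfIntersections_of_transfer hT hΨ h, by simp [hpos, hcob]⟩
  · exact ⟨0, le_rfl, ae_tendsto_selfIntersections_of_not_isCoboundary hT hf hcob, by simp [hcob]⟩
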